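/- Let $K$ be a field that is finitely generated over its prime field, let $v : K \to \mathbb{R}_{\ge 0}$ be a discrete valuation of $K$ (written multiplicatively; its value group is infinite cyclic), let $K_v$ be the completion of $K$ with respect to $v$, and let $E/K$ be a finite extension, not necessarily separable, of separable degree $[E:K]_{\mathrm{s}}$. (i) There are at most $[E:K]_{\mathrm{s}}$ valuations $w : E \to \mathbb{R}_{\ge 0}$ extending $v$ (that is, with $w|_K = v$). (ii) For each such $w$ let $E_w$ be the completion of $E$ with respect to $w$, regarded as a $K_v$-algebra through the continuous extension $K_v \to E_w$ of the inclusion $K \to E$. Assume that $E/K$ is separable, or that the valuation ring $O_v = \{x \in K : v(x) \le 1\}$ is a localization of a finitely generated $\mathbb{Z}$-algebra. (If $K$ has characteristic $p > 0$, the latter says that $O_v$ is a localization of a finitely generated $\mathbb{F}_p$-algebra; it holds, for example, for the valuations given by the closed points of a smooth curve with function field $K$ over a field of constants that is finitely generated over $\mathbb{F}_p$.) Then there is an isomorphism of $K_v$-algebras $$K_v \otimes_K E \;\cong\; \prod_{w \mid v} E_w .$$ -/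

import Mathlib

open scoped NNReal TensorProduct

namespace Valuation

section

variable {K : Type*} [Field K] (v : Valuation K ℝ≥0)

/-- The inclusion of `K` into its completion `K_v`. -/
noncomputable def toCompletion : K →+* v.Completion :=
  (UniformSpace.Completion.coeRingHom : WithVal v →+* v.Completion).comp
    ((WithVal.equiv v).symm : K →+* WithVal v)

/-- `K_v` as a `K`-algebra. -/
noncomputable instance algebraCompletion : Algebra K v.Completion :=
  v.toCompletion.toAlgebra

/-- The set of the real-valued valuations `w` of `E` that extend `v`, that is, whose restriction
to `K` is equal to `v`. -/
noncomputable def extensions (E : Type*) [Field E] [Algebra K E] : Set (Valuation E ℝ≥0) :=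
  {w | w.comap (algebraMap K E) = v}

variable {E : Type*} [Field E] [Algebra K E]

/-- The inclusion `K → E`, where `K` carries the topology of `v` and `E` that of `w`. -/
noncomputable def withValMap (w : Valuation E ℝ≥0) : WithVal v →+* WithVal w :=
  ((WithVal.equiv w).symm : E →+* WithVal w).comp
    ((algebraMap K E).comp (WithVal.equiv v : WithVal v →+* K))

theorem exists_ne_zero_and_lt [hv : v.IsRankOneDiscrete] (r : ℝ≥0) (hr : 0 < r) :
    ∃ x : K, x ≠ 0 ∧ v x < r := by
  obtain ⟨x, hx⟩ := IsRankOneDiscrete.generator_mem_range K v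
  have h1 : v x < 1 := by
    rw [hx]
    exact_mod_cast IsRankOneDiscrete.generator_lt_one v
  have h0 : x ≠ 0 := by
    rintro rfl
    rw [map_zero] at hx
    exact IsRankOneDiscrete.generator_ne_zero v hx.symm
  obtain ⟨n, hn⟩ := exists_pow_lt_of_lt_one hr h1
  exact ⟨x ^ n, pow_ne_zero n h0, by rwa [map_pow]⟩

theorem continuous_withValMap [v.IsRankOneDiscrete] (w : Valuation E ℝ≥0)
    (hw : w.comap (algebraMap K E) = v) : Continuous (withValMap v w) := by
  refine continuous_of_continuousAt_zero (withValMap v w) ?_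
  rw [ContinuousAt, map_zero, (Valued.hasBasis_nhds_zero _ _).tendsto_iff
    (Valued.hasBasis_nhds_zero _ _)]
  intro γ _
  obtain ⟨x, hx0, hx⟩ := v.exists_ne_zero_and_lt
    (MonoidWithZeroHom.ValueGroup₀.embedding γ.1)
    (by
      have h := MonoidWithZeroHom.ValueGroup₀.embedding_strictMono (Units.zero_lt γ)
      rwa [map_zero] at h)
  have hx0' : Valued.v.restrict ((WithVal.equiv v).symm x) ≠ 0 := by
    rw [Ne, restrict_eq_zero_iff]
    exact (v.ne_zero_iff).2 hx0
  refine ⟨Units.mk0 _ hx0', trivial, fun y hy ↦ ?_⟩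
  have hy' : v (WithVal.equiv v y) < v x :=
    (restrict_lt_iff (Valued.v : Valuation (WithVal v) ℝ≥0)).1 hy
  refine (restrict_lt_iff_lt_embedding _).2 ?_
  have hwy : w (algebraMap K E (WithVal.equiv v y)) = v (WithVal.equiv v y) :=
    congrArg (fun u : Valuation K ℝ≥0 ↦ u (WithVal.equiv v y)) hw
  exact (hwy.trans_lt hy').trans hx

/-- The ring homomorphism `K_v → E_w` that extends the inclusion `K → E` by continuity. -/
noncomputable def completionMap [v.IsRankOneDiscrete] (w : v.extensions E) :
    v.Completion →+* w.1.Completion :=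
  UniformSpace.Completion.mapRingHom (withValMap v w.1) (continuous_withValMap v w.1 w.2)

/-- `E_w` as a `K_v`-algebra, for an extension `w` of `v`. -/
noncomputable instance algebraCompletionExtension [v.IsRankOneDiscrete] (w : v.extensions E) :
    Algebra v.Completion w.1.Completion :=
  (completionMap v w).toAlgebra

end

end Valuation

/-! Extensions `w` of `v` correspond to maximal ideals of the Artinian ring `K_v ⊗ E`: `w` gives the
kernel of `K_v ⊗ E → E_w`, and a maximal ideal gives the restriction to `E` of the spectral norm on
its residue field (`kerTensor_injective`, `kerTensor_surjective`). Residue fields embed into an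
algebraic closure of `K_v`, so the ideals are bounded in number by the `K`-embeddings of `E`.

By the Chinese remainder theorem `K_v ⊗ E → ∏ E_w` is onto, and its kernel lies in the nilradical,
so it suffices that `K_v ⊗ E` is reduced. For separable `E/K` this holds over any field. In
characteristic `p`, finiteness of `O_v` over its `p`-th powers makes `K^p`-linear functionals on `K`
bounded; the resulting estimate of coordinates of `z` by those of `z ^ p` passes to the completion.
-/

namespace Valuation

/-! ### Completions as normed fields -/

section Norm

variable {K : Type*} [Field K] (v : Valuation K ℝ≥0)

theorem valued_toCompletion (x : K) :
    (Valued.v (v.toCompletion x) : ℝ≥0) = v x :=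
  Valued.valuedCompletion_apply _

theorem denseRange_toCompletion : DenseRange v.toCompletion :=
  (UniformSpace.Completion.denseRange_coe (α := WithVal v)).comp
    (WithVal.toVal_surjective v).denseRange (UniformSpace.Completion.continuous_coe _)

theorem isNontrivial_of_comap_eq {E : Type*} [Field E] [Algebra K E] [hv : v.IsNontrivial]
    {w : Valuation E ℝ≥0} (hw : w.comap (algebraMap K E) = v) : w.IsNontrivial := by
  obtain ⟨x, hx⟩ := hv.exists_val_nontrivial
  exact ⟨algebraMap K E x, by rw [← hw] at hx; exact hx⟩

instance isNontrivial_extensions {E : Type*} [Field E] [Algebra K E] [v.IsNontrivial]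
    (w : v.extensions E) : w.1.IsNontrivial := v.isNontrivial_of_comap_eq w.2

instance isNontrivial_of_isRankOneDiscrete [v.IsRankOneDiscrete] : v.IsNontrivial := by
  obtain ⟨x, hx⟩ := IsRankOneDiscrete.generator_mem_range K v
  refine ⟨x, ?_, ?_⟩
  · rw [hx]; exact_mod_cast IsRankOneDiscrete.generator_ne_zero v
  · rw [hx]; exact fun h ↦ (IsRankOneDiscrete.generator_lt_one v).ne (Units.ext h)

variable [v.IsNontrivial]

/-- The valuation of the completion has rank one: its values are taken as they are. -/
noncomputable abbrev rankOneCompletion : RankOne (Valued.v : Valuation v.Completion ℝ≥0) where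
  hom' := MonoidWithZeroHom.ValueGroup₀.embedding
  strictMono' := MonoidWithZeroHom.ValueGroup₀.embedding_strictMono
  exists_val_nontrivial := by
    obtain ⟨x, hx⟩ := IsNontrivial.exists_val_nontrivial (v := v)
    exact ⟨v.toCompletion x, by rwa [valued_toCompletion]⟩

/-- The completion of a field with respect to a nontrivial real-valued valuation, as a normed
field. -/
noncomputable scoped instance normedFieldCompletion : NontriviallyNormedField v.Completion :=
  letI := v.rankOneCompletion
  Valued.toNontriviallyNormedField v.Completion ℝ≥0

instance isUltrametricDist_completion : IsUltrametricDist v.Completion :=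
  letI := v.rankOneCompletion
  inferInstanceAs (@IsUltrametricDist v.Completion
    (Valued.toNormedField v.Completion ℝ≥0).toDist)

theorem norm_completion (x : v.Completion) : ‖x‖ = (Valued.v x : ℝ≥0) := by
  let := v.rankOneCompletion
  exact congrArg NNReal.toReal (embedding_restrict Valued.v x)

theorem norm_toCompletion (x : K) : ‖v.toCompletion x‖ = v x := by
  rw [norm_completion, valued_toCompletion]

end Norm

section Extension

variable {K : Type*} [Field K] (v : Valuation K ℝ≥0) [v.IsRankOneDiscrete]
variable {E : Type*} [Field E] [Algebra K E] (w : v.extensions E)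

omit [v.IsRankOneDiscrete] in
theorem extensions_apply (x : K) : w.1 (algebraMap K E x) = v x :=
  congrArg (fun u : Valuation K ℝ≥0 ↦ u x) w.2

theorem completionMap_toCompletion (x : K) :
    completionMap v w (v.toCompletion x) = w.1.toCompletion (algebraMap K E x) :=
  UniformSpace.Completion.mapRingHom_coe
    (continuous_withValMap v w.1 w.2) _

theorem continuous_completionMap : Continuous (completionMap v w) :=
  UniformSpace.Completion.continuous_map

theorem norm_completionMap (x : v.Completion) : ‖completionMap v w x‖ = ‖x‖ := by
  refine congrFun (v.denseRange_toCompletion.equalizer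
    (continuous_norm.comp (continuous_completionMap v w)) continuous_norm ?_) x
  ext x
  simp [completionMap_toCompletion, norm_toCompletion, extensions_apply]

noncomputable scoped instance normedAlgebraCompletion :
    NormedAlgebra v.Completion w.1.Completion where
  __ := algebraCompletionExtension v w
  norm_smul_le r x := by
    rw [Algebra.smul_def, norm_mul]
    exact (congrArg (· * ‖x‖) (norm_completionMap v w r)).le

end Extension

/-! ### Extensions of `v` and maximal ideals of `K_v ⊗ E` -/

section Tensor

variable {K : Type*} [Field K] (v : Valuation K ℝ≥0) [v.IsRankOneDiscrete]
variable {E : Type*} [Field E] [Algebra K E] (w : v.extensions E)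

/-- The canonical homomorphism `K_v ⊗ E → E_w`. -/
noncomputable def tensorToCompletion : v.Completion ⊗[K] E →ₐ[v.Completion] w.1.Completion :=
  letI : Algebra K w.1.Completion := (w.1.toCompletion.comp (algebraMap K E)).toAlgebra
  haveI : @IsScalarTower K v.Completion w.1.Completion
      Algebra.toSMul Algebra.toSMul Algebra.toSMul :=
    .of_algebraMap_eq fun x ↦ (completionMap_toCompletion v w x).symm
  Algebra.TensorProduct.lift (Algebra.ofId _ _)
    (⟨w.1.toCompletion, fun _ ↦ rfl⟩ : E →ₐ[K] w.1.Completion) fun _ _ ↦ .all _ _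

theorem tensorToCompletion_tmul (c : v.Completion) (x : E) :
    tensorToCompletion v w (c ⊗ₜ x) = c • w.1.toCompletion x := by
  rw [Algebra.smul_def]
  let : Algebra K w.1.Completion := (w.1.toCompletion.comp (algebraMap K E)).toAlgebra
  have : @IsScalarTower K v.Completion w.1.Completion
      Algebra.toSMul Algebra.toSMul Algebra.toSMul :=
    .of_algebraMap_eq fun x ↦ (completionMap_toCompletion v w x).symm
  exact Algebra.TensorProduct.lift_tmul ..

theorem tensorToCompletion_one_tmul (x : E) :
    tensorToCompletion v w (1 ⊗ₜ x) = w.1.toCompletion x := by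
  rw [tensorToCompletion_tmul, one_smul]

variable [FiniteDimensional K E]

/-- The image is a finite-dimensional subspace over a complete field, hence closed, and it contains
the dense image of `E`. -/
theorem tensorToCompletion_surjective : Function.Surjective (tensorToCompletion v w) := by
  let V : Submodule v.Completion w.1.Completion := (tensorToCompletion v w).toLinearMap.range
  have hV : IsClosed (V : Set w.1.Completion) := V.closed_of_finiteDimensional
  have hd : Dense (V : Set w.1.Completion) := w.1.denseRange_toCompletion.mono (by
    rintro _ ⟨x, rfl⟩
    exact ⟨1 ⊗ₜ x, tensorToCompletion_one_tmul v w x⟩)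
  intro y
  have : y ∈ (V : Set w.1.Completion) := hV.closure_eq ▸ hd y
  exact this

/-- `E_w` as a quotient of `K_v ⊗ E`. -/
noncomputable def quotientKerTensorEquiv :
    ((v.Completion ⊗[K] E) ⧸ RingHom.ker (tensorToCompletion v w)) ≃ₐ[v.Completion]
      w.1.Completion :=
  Ideal.quotientKerAlgEquivOfSurjective (tensorToCompletion_surjective v w)

instance finiteDimensional_completion : FiniteDimensional v.Completion w.1.Completion :=
  Module.Finite.of_surjective (tensorToCompletion v w).toLinearMap
    (tensorToCompletion_surjective v w)

instance isMaximal_ker_tensorToCompletion :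
    (RingHom.ker (tensorToCompletion v w)).IsMaximal :=
  RingHom.ker_isMaximal_of_surjective _ (tensorToCompletion_surjective v w)

/-- The norm of `E_w` is the unique extension of that of `K_v`. The right side depends on `w` only
through the kernel, so the kernel determines `w`. -/
theorem extensions_apply_eq_spectralValue (x : E) :
    (w.1 x : ℝ) = spectralValue (minpoly v.Completion
      (Ideal.Quotient.mk (RingHom.ker (tensorToCompletion v w)) (1 ⊗ₜ x))) := by
  rw [← norm_toCompletion, NormedAlgebra.norm_eq_spectralNorm v.Completion, spectralNorm,
    ← minpoly.algEquiv_eq (quotientKerTensorEquiv v w)]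
  congr 2
  exact (tensorToCompletion_one_tmul v w x).symm

/-- The maximal ideal of `K_v ⊗ E` that belongs to an extension of `v`. -/
noncomputable def kerTensor (w : v.extensions E) : MaximalSpectrum (v.Completion ⊗[K] E) :=
  ⟨RingHom.ker (tensorToCompletion v w), inferInstance⟩

theorem kerTensor_injective :
    Function.Injective (kerTensor v : v.extensions E → _) := by
  intro w w' h
  have h' : RingHom.ker (tensorToCompletion v w) = RingHom.ker (tensorToCompletion v w') :=
    congrArg MaximalSpectrum.asIdeal h
  refine Subtype.ext (Valuation.ext fun x ↦ NNReal.coe_injective ?_)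
  rw [extensions_apply_eq_spectralValue v w, extensions_apply_eq_spectralValue v w']
  rw [h']

omit [v.IsRankOneDiscrete] [FiniteDimensional K E] in
variable (K) in
theorem tmul_basis_repr {ι : Type*} [Fintype ι] (b : Module.Basis ι K E) (z : v.Completion ⊗[K] E) :
    ∑ i, (b.baseChange v.Completion).repr z i ⊗ₜ b i = z := by
  conv_rhs => rw [← (b.baseChange v.Completion).sum_repr z]
  simp [Module.Basis.baseChange_apply, TensorProduct.smul_tmul']

theorem kerTensor_surjective :
    Function.Surjective (kerTensor v : v.extensions E → _) := by
  rintro ⟨m, hm⟩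
  let F := (v.Completion ⊗[K] E) ⧸ m
  let : Field F := Ideal.Quotient.field m
  let : NormedField F := spectralNorm.normedField v.Completion F
  let : NormedAlgebra v.Completion F := spectralNorm.normedAlgebra v.Completion F
  have : IsUltrametricDist F := IsUltrametricDist.isUltrametricDist_of_isNonarchimedean_norm
    (isNonarchimedean_spectralNorm (K := v.Completion) (L := F))
  let f : E →+* F := (Ideal.Quotient.mk m).comp
    (Algebra.TensorProduct.includeRight : E →ₐ[K] v.Completion ⊗[K] E).toRingHom
  have hf (x : K) : f (algebraMap K E x) = algebraMap v.Completion F (v.toCompletion x) := by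
    refine congrArg (Ideal.Quotient.mk m) ?_
    exact ((Algebra.TensorProduct.includeRight (R := K) (A := v.Completion) (B := E)).commutes x)
  obtain ⟨w, hw⟩ : ∃ w : v.extensions E, ∀ x, (w.1 x : ℝ) = ‖f x‖ := by
    refine ⟨⟨NormedField.valuation.comap f, ?_⟩, fun x ↦ rfl⟩
    ext x
    have : ‖f (algebraMap K E x)‖ = v x := by
      rw [hf, norm_algebraMap', norm_toCompletion]
    exact this
  refine ⟨w, MaximalSpectrum.ext (Ideal.ext fun z ↦ ?_)⟩
  let b := Module.finBasis K E
  -- Both sides are continuous in `c` and agree for coordinates in `K`, by the choice of `w`; hence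
  -- the two maps have the same kernel.
  have key (c : Fin (Module.finrank K E) → v.Completion) :
      ‖tensorToCompletion v w (∑ i, c i ⊗ₜ b i)‖ =
        ‖Ideal.Quotient.mk m (∑ i, c i ⊗ₜ b i)‖ := by
    have h1 (c : Fin (Module.finrank K E) → v.Completion) :
        tensorToCompletion v w (∑ i, c i ⊗ₜ b i) = ∑ i, c i • w.1.toCompletion (b i) := by
      simp only [map_sum, tensorToCompletion_tmul]
    have h2 (c : Fin (Module.finrank K E) → v.Completion) :
        Ideal.Quotient.mk m (∑ i, c i ⊗ₜ b i) = ∑ i, c i • f (b i) := by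
      rw [map_sum]
      refine Finset.sum_congr rfl fun i _ ↦ ?_
      rw [← mul_one (c i), ← smul_eq_mul, ← TensorProduct.smul_tmul', smul_eq_mul, mul_one]
      exact map_smul (Ideal.Quotient.mkₐ v.Completion m) (c i) (1 ⊗ₜ b i)
    rw [h1, h2]
    refine congrFun ((DenseRange.piMap fun _ ↦ v.denseRange_toCompletion).equalizer
      (g := fun c : Fin (Module.finrank K E) → v.Completion ↦
        ‖∑ i, c i • w.1.toCompletion (b i)‖) (h := fun c ↦ ‖∑ i, c i • f (b i)‖)
      (by fun_prop) (by fun_prop) ?_) c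
    ext a
    have h3 : ∑ i, v.toCompletion (a i) • w.1.toCompletion (b i) =
        w.1.toCompletion (∑ i, a i • b i) := by
      simp only [map_sum, Algebra.smul_def, map_mul]
      exact Finset.sum_congr rfl fun i _ ↦
        congrArg (· * _) (completionMap_toCompletion v w (a i))
    have h4 : ∑ i, v.toCompletion (a i) • f (b i) = f (∑ i, a i • b i) := by
      simp only [map_sum, Algebra.smul_def, map_mul, hf]
    simp only [Function.comp_apply, Pi.map_apply, h3, h4, norm_toCompletion, hw]
  rw [← tmul_basis_repr K v b z]
  change tensorToCompletion v w _ = 0 ↔ _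
  rw [← _root_.norm_eq_zero, key, _root_.norm_eq_zero, Ideal.Quotient.eq_zero_iff_mem]

end Tensor
end Valuation

/-! ### Counting maximal ideals, and the decomposition -/

theorem encard_maximalSpectrum_tensorProduct_le (K E L : Type*) [Field K] [Field E] [Algebra K E]
    [FiniteDimensional K E] [Field L] [Algebra K L] :
    ENat.card (MaximalSpectrum (L ⊗[K] E)) ≤ (Field.finSepDegree K E : ℕ∞) := by
  let Ω := AlgebraicClosure L
  have h (m : MaximalSpectrum (L ⊗[K] E)) :
      ∃ φ : L ⊗[K] E →ₐ[L] Ω, RingHom.ker φ = m.asIdeal := by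
    let : Field ((L ⊗[K] E) ⧸ m.asIdeal) := Ideal.Quotient.field m.asIdeal
    refine ⟨(IsAlgClosed.lift (R := L) (S := (L ⊗[K] E) ⧸ m.asIdeal)).comp
      (Ideal.Quotient.mkₐ L m.asIdeal), ?_⟩
    rw [← RingHom.ker_coe_toRingHom, AlgHom.comp_toRingHom,
      RingHom.ker_comp_of_injective _ (RingHom.injective _)]
    exact Ideal.Quotient.mkₐ_ker L m.asIdeal
  choose φ hφ using h
  have hinj : Function.Injective fun m ↦
      ((φ m).restrictScalars K).comp
        (Algebra.TensorProduct.includeRight : E →ₐ[K] L ⊗[K] E) := by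
    intro m m' hm
    refine MaximalSpectrum.ext ?_
    rw [← hφ m, ← hφ m']
    congr 1
    exact Algebra.TensorProduct.ext_ring hm
  calc ENat.card (MaximalSpectrum (L ⊗[K] E)) ≤ ENat.card (E →ₐ[K] Ω) :=
        ENat.card_le_card_of_injective hinj
    _ = (Field.finSepDegree K E : ℕ∞) := by
        rw [Field.finSepDegree_eq_of_isAlgClosed K E Ω, ENat.card_eq_coe_natCard]

theorem isReduced_tensorProduct_of_isSeparable (K E L : Type*) [Field K] [Field E] [Algebra K E]
    [FiniteDimensional K E] [Field L] [Algebra K L] [Algebra.IsSeparable K E] :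
    IsReduced (L ⊗[K] E) :=
  have := Algebra.FormallyUnramified.of_isSeparable K E
  Algebra.FormallyUnramified.isReduced_of_field L (L ⊗[K] E)

namespace Valuation

variable {K : Type*} [Field K] (v : Valuation K ℝ≥0) [v.IsRankOneDiscrete]
variable {E : Type*} [Field E] [Algebra K E] [FiniteDimensional K E]

theorem encard_extensions_le :
    (v.extensions E).encard ≤ (Field.finSepDegree K E : ℕ∞) :=
  (ENat.card_le_card_of_injective (kerTensor_injective v)).trans
    (encard_maximalSpectrum_tensorProduct_le K E v.Completion)

/-- Primes of an Artinian ring are maximal, so each one is the kernel of some `w`. -/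
theorem iInf_ker_tensorToCompletion_le_nilradical :
    ⨅ w : v.extensions E, RingHom.ker (tensorToCompletion v w) ≤
      nilradical (v.Completion ⊗[K] E) := by
  have : IsArtinianRing (v.Completion ⊗[K] E) := .of_finite v.Completion _
  rw [nilradical_eq_sInf]
  refine le_sInf fun J (hJ : J.IsPrime) ↦ ?_
  obtain ⟨w, hw⟩ := kerTensor_surjective v
    (⟨J, IsArtinianRing.isMaximal_of_isPrime J⟩ : MaximalSpectrum (v.Completion ⊗[K] E))
  exact (iInf_le _ w).trans_eq (congrArg MaximalSpectrum.asIdeal hw)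

theorem pi_tensorToCompletion_surjective :
    Function.Surjective (AlgHom.pi fun w : v.extensions E ↦ tensorToCompletion v w) := by
  have : Finite (v.extensions E) :=
    Set.encard_ne_top_iff.mp (ne_top_of_le_ne_top (ENat.natCast_ne_top _) (encard_extensions_le v))
  intro y
  choose x hx using fun w ↦ tensorToCompletion_surjective v w (y w)
  obtain ⟨z, hz⟩ := Ideal.pi_quotient_surjective
    (I := fun w : v.extensions E ↦ RingHom.ker (tensorToCompletion v w))
    (fun w w' hw ↦ Ideal.isCoprime_of_isMaximal fun h ↦
      hw (kerTensor_injective v (MaximalSpectrum.ext h))) fun w ↦ Ideal.Quotient.mk _ (x w)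
  refine ⟨z, funext fun w ↦ ?_⟩
  have h := (RingHom.sub_mem_ker_iff _).1 (Ideal.Quotient.eq.1 (hz w))
  exact h.trans (hx w)

theorem nonempty_algEquiv_pi_completion [IsReduced (v.Completion ⊗[K] E)] :
    Nonempty ((v.Completion ⊗[K] E) ≃ₐ[v.Completion]
      ((w : v.extensions E) → w.1.Completion)) := by
  refine ⟨AlgEquiv.ofBijective (AlgHom.pi fun w : v.extensions E ↦ tensorToCompletion v w)
    ⟨(injective_iff_map_eq_zero _).2 fun x hx ↦ ?_, pi_tensorToCompletion_surjective v⟩⟩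
  have h : x ∈ nilradical (v.Completion ⊗[K] E) := by
    refine iInf_ker_tensorToCompletion_le_nilradical v (Ideal.mem_iInf.2 fun w ↦ ?_)
    exact congrFun hx w
  rwa [nilradical_eq_zero] at h

end Valuation

/-! ### Reducedness in characteristic `p` -/

/-- In characteristic `p`, a ring essentially of finite type over `ℤ` is finite over its subring
of `p`-th powers. -/
theorem exists_finset_sum_pow_mul (O : Type*) [CommRing O] (p : ℕ) [hp : Fact p.Prime] [CharP O p]
    [Algebra.EssFiniteType ℤ O] :
    ∃ s : Finset O, ∀ x, ∃ a : O → O, x = ∑ m ∈ s, a m ^ p * m := by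
  let R := (frobenius O p).range
  have hR (x : O) : x ^ p ∈ R := ⟨x, rfl⟩
  let t := Algebra.EssFiniteType.finset ℤ O
  let A := Algebra.adjoin R (t : Set O)
  have hA (x : O) : x ^ p ∈ A := A.algebraMap_mem ⟨x ^ p, hR x⟩
  have hle : Algebra.EssFiniteType.subalgebra ℤ O ≤ A.restrictScalars ℤ :=
    Algebra.adjoin_le Algebra.subset_adjoin
  have htop : A = ⊤ := by
    refine Algebra.eq_top_iff.2 fun x ↦ ?_
    obtain ⟨⟨a, u⟩, h⟩ := IsLocalization.surj (Algebra.EssFiniteType.submonoid ℤ O) x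
    obtain ⟨i, hi⟩ : ∃ i : O, (u.1 : O) * i = 1 := (show IsUnit (u.1 : O) from u.2).exists_right_inv
    -- Denominators may be taken to be `p`-th powers: `a / u = a * u ^ (p - 1) * (1 / u) ^ p`.
    have hx : x = a * (u.1 : O) ^ (p - 1) * i ^ p := by
      calc x = x * ((u.1 : O) * i) ^ p := by rw [hi, one_pow, mul_one]
        _ = x * u.1 * (u.1 : O) ^ (p - 1) * i ^ p := by
          rw [mul_pow, ← mul_pow_sub_one hp.out.ne_zero (u.1 : O)]; ring
        _ = _ := congrArg (· * (u.1 : O) ^ (p - 1) * i ^ p) h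
    rw [hx]
    exact A.mul_mem (A.mul_mem (hle a.2) (A.pow_mem (hle u.1.2) _)) (hA _)
  have hfg : A.toSubmodule.FG := fg_adjoin_of_finite t.finite_toSet fun x _ ↦ by
    refine .of_pow hp.out.pos ?_
    exact isIntegral_algebraMap (R := R) (x := ⟨x ^ p, hR x⟩)
  obtain ⟨s, hs⟩ := hfg
  refine ⟨s, fun x ↦ ?_⟩
  have hx : x ∈ Submodule.span R (s : Set O) := by
    rw [hs, htop]; trivial
  obtain ⟨f, -, rfl⟩ := Submodule.mem_span_finset.1 hx
  choose g hg using fun m ↦ (f m).2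
  exact ⟨g, Finset.sum_congr rfl fun m _ ↦ congrArg (· * m) (hg m).symm⟩

namespace Valuation

variable {K : Type*} [Field K] (v : Valuation K ℝ≥0)

/-- If the valuation ring of `v` is finite over its subring of `p`-th powers, then the linear
functionals on `K` over the subfield of `p`-th powers are bounded. -/
theorem exists_forall_map_le_mul [hv : v.IsNontrivial] (p : ℕ) [hp : Fact p.Prime] [CharP K p]
    (hO : ∃ s : Finset v.valuationSubring, ∀ x, ∃ a : v.valuationSubring → v.valuationSubring,
      x = ∑ m ∈ s, a m ^ p * m)
    (l : K →ₗ[(frobenius K p).fieldRange] K) : ∃ C : ℝ≥0, ∀ x, v (l x) ≤ C * v x := by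
  obtain ⟨s, hs⟩ := hO
  have hl (a x : K) : l (a ^ p * x) = a ^ p * l x :=
    l.map_smul (⟨a ^ p, a, rfl⟩ : (frobenius K p).fieldRange) x
  let C := s.sup fun m ↦ v (l m)
  -- Here `x / y ^ p` lies in `O_v`, so it is a combination of the `m ∈ s` with `p`-th powers of
  -- integral elements as coefficients.
  have h1 (x y : K) (hy : y ≠ 0) (hxy : v x ≤ v y ^ p) : v (l x) ≤ C * v y ^ p := by
    have hvy : v y ≠ 0 := (v.ne_zero_iff).2 hy
    obtain ⟨a, ha⟩ := hs ⟨x / y ^ p, by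
      change v _ ≤ 1
      rw [map_div₀, map_pow]
      exact div_le_one_of_le₀ hxy zero_le⟩
    have hx : x = ∑ m ∈ s, (y * a m) ^ p * m := by
      have := congrArg (fun z : v.valuationSubring ↦ y ^ p * (z : K)) ha
      simp only [mul_div_cancel₀ _ (pow_ne_zero p hy)] at this
      rw [this]
      push_cast
      rw [Finset.mul_sum]
      exact Finset.sum_congr rfl fun m _ ↦ by ring
    rw [hx, map_sum]
    refine v.map_sum_le fun m hm ↦ ?_
    have ham : v (a m) ≤ 1 := (a m).2
    rw [hl, map_mul, map_pow, map_mul, mul_comm]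
    gcongr
    · exact Finset.le_sup (f := fun m : v.valuationSubring ↦ v (l m)) hm
    · exact mul_le_of_le_one_right' ham
  obtain ⟨y, hy⟩ : ∃ y, 1 < v y := by
    obtain ⟨y, hy0, hy1⟩ := hv.exists_val_nontrivial
    rcases lt_or_gt_of_ne hy1 with h | h
    · exact ⟨y⁻¹, by rw [map_inv₀]; exact (one_lt_inv₀ (pos_iff_ne_zero.2 hy0)).2 h⟩
    · exact ⟨y, h⟩
  have hy0 : y ≠ 0 := (v.ne_zero_iff).1 (zero_lt_one.trans hy).ne'
  refine ⟨C * v y ^ p, fun x ↦ ?_⟩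
  rcases eq_or_ne x 0 with rfl | hx
  · simp
  -- Powers of `v y ^ p` approximate `v x` from above up to one factor `v y ^ p`, which is absorbed
  -- into the constant.
  obtain ⟨n, hn1, hn2⟩ := exists_mem_Ioc_zpow (pos_iff_ne_zero.2 ((v.ne_zero_iff).2 hx))
    (one_lt_pow₀ hy hp.out.ne_zero)
  have h2 : v (y ^ (n + 1)) ^ p = (v y ^ p) ^ (n + 1) := by
    rw [map_zpow₀, ← zpow_natCast, ← zpow_natCast, ← zpow_mul, ← zpow_mul, mul_comm]
  refine (h1 x (y ^ (n + 1)) (zpow_ne_zero _ hy0) (h2 ▸ hn2)).trans ?_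
  rw [h2, zpow_add_one₀ (pow_ne_zero _ (zero_lt_one.trans hy).ne'), mul_assoc, mul_comm (v y ^ p)]
  gcongr

variable {E : Type*} [Field E] [Algebra K E]

theorem linearIndependent_pow_char {ι : Type*} [Fintype ι] (p : ℕ) [hp : Fact p.Prime] [CharP K p]
    {b : ι → E} (hb : LinearIndependent K b) :
    LinearIndependent (frobenius K p).fieldRange fun i ↦ b i ^ p := by
  have : CharP E p := charP_of_injective_algebraMap (algebraMap K E).injective p
  rw [Fintype.linearIndependent_iff] at hb ⊢
  intro g hg i
  choose a ha using fun i ↦ (g i).2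
  have h : (∑ i, a i • b i) ^ p = 0 := by
    rw [sum_pow_char, ← hg]
    refine Finset.sum_congr rfl fun i _ ↦ ?_
    rw [smul_pow]
    exact congrArg (· • b i ^ p) (ha i)
  have h0 := hb a (eq_zero_of_pow_eq_zero h) i
  refine Subtype.ext ((ha i).symm.trans ?_)
  rw [h0, map_zero]
  rfl

/-- The `b i ^ p` are independent over `K^p`, so their `j`-th coordinate function extends to a
functional on `E`. -/
theorem exists_linearMap_pow_char {ι : Type*} [Fintype ι] [DecidableEq ι] (p : ℕ)
    [hp : Fact p.Prime] [CharP K p] {b : ι → E} (hb : LinearIndependent K b) (j : ι) :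
    ∃ l : E →ₗ[(frobenius K p).fieldRange] K, ∀ a : ι → K, l (∑ i, a i ^ p • b i ^ p) = a j ^ p := by
  have hli := linearIndependent_pow_char p hb
  obtain ⟨g, hg⟩ := LinearMap.exists_extend hli.repr
  have hgb (i : ι) : g (b i ^ p) = Finsupp.single i 1 := by
    rw [← hli.repr_eq_single i ⟨b i ^ p, Submodule.subset_span ⟨i, rfl⟩⟩ rfl, ← hg]
    rfl
  refine ⟨(Algebra.linearMap (frobenius K p).fieldRange K ∘ₗ Finsupp.lapply j) ∘ₗ g, fun a ↦ ?_⟩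
  have hga (i : ι) : g (a i ^ p • b i ^ p) =
      (⟨a i ^ p, a i, rfl⟩ : (frobenius K p).fieldRange) • Finsupp.single i 1 := by
    rw [← hgb]
    exact g.map_smul (⟨a i ^ p, a i, rfl⟩ : (frobenius K p).fieldRange) _
  simp only [LinearMap.comp_apply, map_sum, hga, Finsupp.smul_single, Finsupp.lapply_apply]
  rw [Finset.sum_eq_single j]
  · simp only [Finsupp.single_eq_same, smul_eq_mul, mul_one, Algebra.linearMap_apply]
    rfl
  · intro i _ hi
    simp [Finsupp.single_eq_of_ne' hi]
  · simp

variable [FiniteDimensional K E]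

theorem isReduced_tensorProduct_of_essFiniteType [v.IsNontrivial] (p : ℕ) [hp : Fact p.Prime]
    [CharP K p] [Algebra.EssFiniteType ℤ v.valuationSubring] :
    IsReduced (v.Completion ⊗[K] E) := by
  classical
  have : CharP E p := charP_of_injective_algebraMap (algebraMap K E).injective p
  have : CharP (v.Completion ⊗[K] E) p :=
    charP_of_injective_algebraMap (algebraMap K (v.Completion ⊗[K] E)).injective p
  have : CharP v.valuationSubring p :=
    (algebraMap v.valuationSubring K).charP Subtype.val_injective p
  let b := Module.finBasis K E
  let β i j : K := b.repr (b j ^ p) i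
  have hβ (j) : b j ^ p = ∑ i, β i j • b i := (b.sum_repr _).symm
  -- The `i`-th coordinate of `(∑ j, c j ⊗ b j) ^ p`.
  let P (i) (c : Fin (Module.finrank K E) → v.Completion) : v.Completion :=
    ∑ j, c j ^ p * v.toCompletion (β i j)
  -- For `c` in `K`, `c j ^ p` is a functional of the `p`-th power, hence a sum of bounded
  -- functionals of the `P i c`; the inequality is closed, so density extends it to `K_v`.
  have key (j) : ∃ C : Fin (Module.finrank K E) → ℝ≥0, ∀ c, ‖c j‖ ^ p ≤ ∑ i, C i * ‖P i c‖ := by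
    obtain ⟨l, hl⟩ := exists_linearMap_pow_char p b.linearIndependent j
    choose C hC using fun i ↦ v.exists_forall_map_le_mul p
      (exists_finset_sum_pow_mul v.valuationSubring p)
      (l ∘ₗ (LinearMap.toSpanSingleton K E (b i)).restrictScalars (frobenius K p).fieldRange)
    refine ⟨C, fun c ↦ ?_⟩
    refine (DenseRange.piMap fun _ ↦ v.denseRange_toCompletion).induction_on c
      (isClosed_le (by fun_prop) (by fun_prop)) fun a ↦ ?_
    have hP (i) : P i (Pi.map (fun _ ↦ v.toCompletion) a) =
        v.toCompletion (∑ j, a j ^ p * β i j) := by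
      simp [P]
    have ha : a j ^ p = ∑ i, l ((∑ j, a j ^ p * β i j) • b i) := by
      rw [← hl, ← map_sum]
      congr 1
      simp only [hβ, Finset.smul_sum, Finset.sum_smul, smul_smul]
      exact Finset.sum_comm
    simp only [Pi.map_apply, hP, norm_toCompletion]
    rw [← NNReal.coe_pow, ← map_pow, ha]
    norm_cast
    refine v.map_sum_le fun i hi ↦ (hC i _).trans ?_
    exact Finset.single_le_sum (f := fun i ↦ C i * v (∑ j, a j ^ p * β i j))
      (fun _ _ ↦ zero_le) hi
  refine (isReduced_iff_pow_one_lt p hp.out.one_lt).2 fun z hz ↦ ?_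
  rw [← tmul_basis_repr K v b z] at hz ⊢
  set c := (b.baseChange v.Completion).repr z
  have hPc (i) : P i c = 0 := by
    have h : ∑ i, P i c ⊗ₜ[K] b i = 0 := by
      rw [← hz, sum_pow_char]
      simp only [Algebra.TensorProduct.tmul_pow, hβ, TensorProduct.tmul_sum, P,
        TensorProduct.sum_tmul]
      rw [Finset.sum_comm]
      refine Finset.sum_congr rfl fun j _ ↦ Finset.sum_congr rfl fun i _ ↦ ?_
      rw [TensorProduct.tmul_smul, TensorProduct.smul_tmul', Algebra.smul_def, mul_comm]
      rfl
    have h' : ∑ i, P i c • b.baseChange v.Completion i = 0 := by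
      rw [← h]
      simp [Module.Basis.baseChange_apply, TensorProduct.smul_tmul']
    exact Fintype.linearIndependent_iff.1 (b.baseChange v.Completion).linearIndependent _ h' i
  refine Finset.sum_eq_zero fun j _ ↦ ?_
  obtain ⟨C, hC⟩ := key j
  have h := hC c
  simp only [hPc, norm_zero, mul_zero, Finset.sum_const_zero] at h
  have hcj : c j = 0 := _root_.norm_eq_zero.1
    (eq_zero_of_pow_eq_zero (le_antisymm h (by positivity)))
  rw [hcj, TensorProduct.zero_tmul]

end Valuation

theorem mainTheorem10 {K E : Type*} [Field K] [Field.FG K]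
    [Field E] [Algebra K E] [FiniteDimensional K E]
    (v : Valuation K ℝ≥0) [v.IsRankOneDiscrete] :
    (v.extensions E).encard ≤ (Field.finSepDegree K E : ℕ∞) ∧
      ((Algebra.IsSeparable K E ∨ Algebra.EssFiniteType ℤ v.valuationSubring) →
        Nonempty ((v.Completion ⊗[K] E) ≃ₐ[v.Completion]
          ((w : v.extensions E) → w.1.Completion))) := by
  refine ⟨v.encard_extensions_le, fun h ↦ ?_⟩
  have : IsReduced (v.Completion ⊗[K] E) := by
    rcases h with h | h
    · exact isReduced_tensorProduct_of_isSeparable K E v.Completion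
    · obtain ⟨p, _⟩ := CharP.exists K
      rcases CharP.char_is_prime_or_zero K p with hp | rfl
      · have : Fact p.Prime := ⟨hp⟩
        exact v.isReduced_tensorProduct_of_essFiniteType p
      · have := CharP.charP_to_charZero K
        exact isReduced_tensorProduct_of_isSeparable K E v.Completion
  exact v.nonempty_algEquiv_pi_completion
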